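/- **Setting.** Let $V$ be a finite set and let $\mathcal H=(V,H)$ be a hypergraph whose hyperedges are nonempty sets of at most $r$ vertices. Each vertex $i$ has $k_i\ge 1$ states, with $k_i\le K$. Each set $h=\{i_1,\dots,i_\ell\}\subseteq V$ carries a real tensor $\theta^{h}$ indexed by $[k_{i_1}]\times\dots\times[k_{i_\ell}]$, and $\theta^h=0$ if $h\notin H$. The Markov random field is the random vector $X=(X_i)_{i\in V}$ with $$\Pr(X=x)=\exp\Big(\sum_{h\in H}\theta^h(x_h)-C\Big),$$ where $C$ is the normalizing constant. It is assumed to be in canonical form: for every tensor $\theta^h$, the sum over each tensor fiber (one index varies, the others are fixed) is zero. Let $G$ be the graph obtained from $\mathcal H$ by replacing every hyperedge with a clique, let $\Gamma(i)$ and $d_i=|\Gamma(i)|$ be the neighborhood and degree of $i$ in $G$, and let $D$ be an upper bound on the maximum degree with $D\ge r-1$. A hyperedge is maximal if no hyperedge of strictly larger size contains it, and $h$ is $\alpha$-nonvanishing if some entry of $\theta^h$ is at least $\alpha$ in absolute value. Put $$\gamma=\max_{v\in V}\ \sum_{h\in H,\ v\in h}\ \max_a|\theta^h(a)|,\qquad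 \delta=\tfrac1K e^{-2\gamma}.$$ For disjoint sets $I,S\subseteq V\setminus\{u\}$ let $I(X_u;X_I\mid X_S)$ be the conditional mutual information (with natural logarithms) and let $$\nu_{u,I|S}=\mathbf E_{R,G}\,\mathbf E_{X_S}\Big|\Pr(X_u=R,X_I=G\mid X_S)-\Pr(X_u=R\mid X_S)\Pr(X_I=G\mid X_S)\Big|,$$ where $R$ is uniform on $[k_u]$ and, independently, $G$ is uniform on $\prod_{i\in I}[k_i]$. **Theorem.** Let $\alpha>0$, let $u$ be a vertex such that all maximal hyperedges containing $u$ are $\alpha$-nonvanishing, and let $S\subseteq V\setminus\{u\}$ be a set that does not contain all of $\Gamma(u)$. Let $d=d_u$, and let $I$ be chosen uniformly at random among the subsets of $\Gamma(u)\setminus S$ of size $\min(r-1,|\Gamma(u)\setminus S|)$. Then $$\mathbf E_I\Big[\sqrt{\tfrac12 I(X_u;X_I\mid X_S)}\Big]\ \ge\ \mathbf E_I\big[\nu_{u,I|S}\big]\ \ge\ \frac{4\alpha^2\,\delta^{\,r+d-1}}{r^{2r}\,K^{r+1}\binom{D}{r-1}\,\gamma\,e^{2\gamma}}.$$ -/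

import Mathlib

open scoped BigOperators

/-- A Markov random field of order `r` on a finite vertex set `V`: a hypergraph with nonempty
hyperedges of at most `r` vertices, a positive number `k i` of states for every vertex `i`, and for
every set `h` of vertices a tensor `potential h` indexed by the joint states of the vertices of
`h`, which is the zero tensor when `h` is not a hyperedge. -/
structure MarkovRandomField (V : Type*) [Fintype V] [DecidableEq V] (r : ℕ) where
  k : V → ℕ
  k_pos : ∀ i, 0 < k i
  hyperedges : Finset (Finset V)
  nonempty_of_mem : ∀ h ∈ hyperedges, h.Nonempty
  card_le_of_mem : ∀ h ∈ hyperedges, h.card ≤ r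
  potential : ∀ h : Finset V, (∀ i : h, Fin (k i)) → ℝ
  potential_eq_zero : ∀ h, h ∉ hyperedges → potential h = 0

namespace MarkovRandomField

variable {V : Type*} [Fintype V] [DecidableEq V] {r : ℕ} (M : MarkovRandomField V r)

/-- Joint states of all vertices. -/
abbrev Config : Type _ := ∀ i : V, Fin (M.k i)

/-- Joint states of the vertices in `A`. -/
abbrev PartialConfig (A : Finset V) : Type _ := ∀ i : A, Fin (M.k i)

instance (i : V) : Nonempty (Fin (M.k i)) := ⟨⟨0, M.k_pos i⟩⟩

/-! ### The law -/

/-- The exponent: the sum of all clique potentials at `x`. -/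
noncomputable def energy (x : M.Config) : ℝ :=
  ∑ h ∈ M.hyperedges, M.potential h (h.restrict x)

/-- The partition function. -/
noncomputable def partitionFunction : ℝ := ∑ x : M.Config, Real.exp (M.energy x)

/-- `Pr(X = x) = exp (energy x - C)` with `C` the log-partition function. -/
noncomputable def pmf (x : M.Config) : ℝ :=
  Real.exp (M.energy x - Real.log M.partitionFunction)

theorem partitionFunction_pos : 0 < M.partitionFunction :=
  Finset.sum_pos (fun _ _ => Real.exp_pos _) Finset.univ_nonempty

theorem pmf_pos (x : M.Config) : 0 < M.pmf x := Real.exp_pos _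

theorem sum_pmf : ∑ x : M.Config, M.pmf x = 1 := by
  simp only [pmf, Real.exp_sub, Real.exp_log M.partitionFunction_pos, ← Finset.sum_div]
  exact div_self M.partitionFunction_pos.ne'

/-- `Pr(A)` for an event `A`. -/
noncomputable def prob (A : Set M.Config) : ℝ := ∑ x : M.Config, A.indicator M.pmf x

/-- `Pr(A | B)`. -/
noncomputable def condProb (A B : Set M.Config) : ℝ := M.prob (A ∩ B) / M.prob B

/-- The event `X_u = R`. -/
def nodeEvent (u : V) (R : Fin (M.k u)) : Set M.Config := {x | x u = R}

/-- The event `X_A = a`. -/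
def setEvent (A : Finset V) (a : M.PartialConfig A) : Set M.Config := {x | A.restrict x = a}

/-! ### Canonical form and maximal hyperedges -/

/-- All tensors are centered: every tensor fiber, obtained by letting one index vary over all its
values while the other indices are fixed, sums to zero. -/
def IsCanonical : Prop :=
  ∀ (h : Finset V) (i : h) (a : M.PartialConfig h),
    ∑ c : Fin (M.k i), M.potential h (Function.update a i c) = 0

/-- `h` is a hyperedge that no hyperedge of strictly larger size contains. -/
def IsMaximalHyperedge (h : Finset V) : Prop :=
  h ∈ M.hyperedges ∧ ¬ ∃ h' ∈ M.hyperedges, h.card < h'.card ∧ h ⊆ h'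

/-- The tensor of `h` has an entry of absolute value at least `α`. -/
def IsNonvanishing (α : ℝ) (h : Finset V) : Prop :=
  ∃ a : M.PartialConfig h, α ≤ |M.potential h a|

/-! ### The graph -/

/-- The graph obtained by replacing every hyperedge with a clique. -/
def graph : SimpleGraph V where
  Adj i j := i ≠ j ∧ ∃ h ∈ M.hyperedges, i ∈ h ∧ j ∈ h
  symm := ⟨fun _ _ ⟨hne, h, hh, hi, hj⟩ => ⟨hne.symm, h, hh, hj, hi⟩⟩
  loopless := ⟨fun _ h => h.1 rfl⟩

instance : DecidableRel M.graph.Adj := fun i j =>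
  inferInstanceAs (Decidable (i ≠ j ∧ ∃ h ∈ M.hyperedges, i ∈ h ∧ j ∈ h))

/-! ### Parameters -/

/-- The largest absolute value of an entry of the tensor of `h` (a maximum over a finite nonempty
set). -/
noncomputable def maxEntry (h : Finset V) : ℝ := ⨆ a : M.PartialConfig h, |M.potential h a|

/-- `γ`: the largest value, over all vertices `v`, of the sum of the maximal entries of the tensors
of the hyperedges that contain `v`. -/
noncomputable def gamma : ℝ := ⨆ v : V, ∑ h ∈ M.hyperedges with v ∈ h, M.maxEntry h

/-- `δ = exp (-2 γ) / K`. -/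
noncomputable def delta (K : ℕ) : ℝ := 1 / (K : ℝ) * Real.exp (-2 * M.gamma)

/-! ### Information-theoretic quantities -/

/-- `I(X_u; X_I | X_S = s)`: the Kullback-Leibler divergence (natural logarithm) of the product of
the conditional laws of `X_u` and `X_I` from their joint conditional law. -/
noncomputable def mutualInfoGiven (u : V) (I S : Finset V) (s : M.PartialConfig S) : ℝ :=
  ∑ R : Fin (M.k u), ∑ G : M.PartialConfig I,
    M.condProb (M.nodeEvent u R ∩ M.setEvent I G) (M.setEvent S s) *
      Real.log (M.condProb (M.nodeEvent u R ∩ M.setEvent I G) (M.setEvent S s) /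
        (M.condProb (M.nodeEvent u R) (M.setEvent S s) *
          M.condProb (M.setEvent I G) (M.setEvent S s)))

/-- `I(X_u; X_I | X_S)`. -/
noncomputable def condMutualInfo (u : V) (I S : Finset V) : ℝ :=
  ∑ s : M.PartialConfig S, M.prob (M.setEvent S s) * M.mutualInfoGiven u I S s

/-- `ν_{u, I | S}`; the outer averages are over uniformly random states `R` of `u` and `G` of `I`. -/
noncomputable def nu (u : V) (I S : Finset V) : ℝ :=
  𝔼 R : Fin (M.k u), 𝔼 G : M.PartialConfig I,
    ∑ s : M.PartialConfig S, M.prob (M.setEvent S s) *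
      |M.condProb (M.nodeEvent u R ∩ M.setEvent I G) (M.setEvent S s) -
        M.condProb (M.nodeEvent u R) (M.setEvent S s) *
          M.condProb (M.setEvent I G) (M.setEvent S s)|

/-- The subsets of `Γ(u) \ S` of size `min (r - 1, |Γ(u) \ S|)`. -/
def testSets (u : V) (S : Finset V) : Finset (Finset V) :=
  (M.graph.neighborFinset u \ S).powersetCard (min (r - 1) (M.graph.neighborFinset u \ S).card)

end MarkovRandomField

/-! Fix a neighbor `i` of `u` outside `S` and a hyperedge `h` containing both. For a state `R` of
`u`, let `localEnergy` be the sum of the potentials at `u` with `u` put in state `R`. Both bounds on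
`ν` come from the conditional covariance, given `X_S`, of this local energy with the indicator of
`X_u = R`, summed over `R`.

From below: by the tower property the indicator may be replaced by its conditional probability given
all other vertices, a softmax of the local energies. Softmax is strongly monotone
(`sum_sub_mul_softmax_sub_ge`), so the covariance dominates `δ² k_u` times the sum over `R` of the
conditional variances of the local energies. Such a variance is bounded below by comparing the law
with counting measure on the states of `Γ(u)`, at the cost of `δ ^ d` (`delta_pow_mul_sum_pmf_le`).
For counting measure, canonical form makes the tensors orthogonal to each other, and makes the
tensor of `h` orthogonal to anything that does not depend on `X_i`, such as the conditional mean
given `X_S`. Hence one entry of `h` survives (`sum_prob_mul_condVar_localEnergy_ge`).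

From above: the local energy is, up to terms fixed by `X_S`, an average over the sets `I` of
functions that see only `X_I` and `X_S` (`sum_condCov_wager`). Each is bounded by `binom(D, r-1) γ`,
so its covariance is at most a multiple of `ν` (`sum_condCov_le_nu`).

The comparison of `ν` with mutual information is Pinsker's inequality for single atoms, followed by
Cauchy-Schwarz over the states of `S`. -/

namespace MarkovRandomField

variable {V : Type*} [Fintype V] [DecidableEq V] {r : ℕ} (M : MarkovRandomField V r)

/-! ### Sums over the configurations that agree with a given one off a set of vertices -/

/-- The configurations that agree with `x` off `A`. -/
def cyl (A : Finset V) (x : M.Config) : Finset M.Config :=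
  Finset.univ.filter fun z => ∀ i, i ∉ A → z i = x i

variable {M}

theorem mem_cyl {A : Finset V} {x z : M.Config} : z ∈ M.cyl A x ↔ ∀ i, i ∉ A → z i = x i := by
  simp [cyl]

theorem cyl_univ (x : M.Config) : M.cyl Finset.univ x = Finset.univ := by
  ext z; simp [mem_cyl]

theorem cyl_empty (x : M.Config) : M.cyl ∅ x = {x} := by
  ext z; simp [mem_cyl, funext_iff]

theorem update_mem_cyl {A : Finset V} {x z : M.Config} {i : V} (hi : i ∈ A)
    (hz : z ∈ M.cyl A x) (c : Fin (M.k i)) : Function.update z i c ∈ M.cyl A x := by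
  rw [mem_cyl] at hz ⊢
  intro j hj
  rw [Function.update_of_ne (by rintro rfl; exact hj hi)]
  exact hz j hj

/-- Resampling the state of `i` uniformly does not change a uniform average. -/
theorem sum_cyl_sum_update {A : Finset V} (x : M.Config) {i : V} (hi : i ∈ A)
    (g : M.Config → ℝ) :
    ∑ z ∈ M.cyl A x, ∑ c : Fin (M.k i), g (Function.update z i c) =
      (M.k i : ℝ) * ∑ z ∈ M.cyl A x, g z := by
  have h : ∑ z ∈ M.cyl A x, ∑ c : Fin (M.k i), g (Function.update z i c) =
      ∑ z ∈ M.cyl A x, ∑ _c : Fin (M.k i), g z := by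
    rw [← Finset.sum_product', ← Finset.sum_product']
    -- Exchanging the `i`-th coordinate of `z` with the spare state `c` is an involution.
    refine Finset.sum_nbij' (fun p => (Function.update p.1 i p.2, p.1 i))
      (fun p => (Function.update p.1 i p.2, p.1 i)) ?_ ?_ ?_ ?_ ?_
    · intro p hp
      simp only [Finset.mem_product, Finset.mem_univ, and_true] at hp ⊢
      exact update_mem_cyl hi hp _
    · intro p hp
      simp only [Finset.mem_product, Finset.mem_univ, and_true] at hp ⊢
      exact update_mem_cyl hi hp _
    · intro p _; ext1 <;> simp
    · intro p _; ext1 <;> simp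
    · intro p _; rfl
  rw [h]
  simp [Finset.mul_sum]

theorem sum_sum_update (i : V) (g : M.Config → ℝ) :
    ∑ z : M.Config, ∑ c : Fin (M.k i), g (Function.update z i c) = (M.k i : ℝ) * ∑ z, g z := by
  have x : M.Config := fun i => ⟨0, M.k_pos i⟩
  simpa [cyl_univ] using sum_cyl_sum_update x (Finset.mem_univ i) g

theorem natCast_k_pos (i : V) : (0 : ℝ) < M.k i := Nat.cast_pos.2 (M.k_pos i)

/-- Source of all orthogonality: summing over the states of `i` first, `g` factors out and `f` sums
to zero. -/
theorem sum_cyl_mul_eq_zero {A : Finset V} (x : M.Config) {i : V} (hi : i ∈ A)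
    {f g : M.Config → ℝ}
    (hf : ∀ z, ∑ c : Fin (M.k i), f (Function.update z i c) = 0)
    (hg : ∀ z (c : Fin (M.k i)), g (Function.update z i c) = g z) :
    ∑ z ∈ M.cyl A x, f z * g z = 0 := by
  have h := sum_cyl_sum_update x hi fun z => f z * g z
  simp only [hg, ← Finset.sum_mul, hf, zero_mul, Finset.sum_const_zero] at h
  exact (mul_eq_zero.1 h.symm).resolve_left (natCast_k_pos i).ne'

theorem sum_cyl_insert {A : Finset V} (x : M.Config) {j : V} (hj : j ∉ A) (H : M.Config → ℝ) :
    ∑ z ∈ M.cyl (insert j A) x, H z =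
      ∑ c : Fin (M.k j), ∑ z ∈ M.cyl A (Function.update x j c), H z := by
  rw [← Finset.sum_fiberwise (M.cyl (insert j A) x) (fun z => z j)]
  refine Finset.sum_congr rfl fun c _ => Finset.sum_congr ?_ fun _ _ => rfl
  ext z
  simp only [Finset.mem_filter, mem_cyl, Finset.mem_insert, not_or]
  constructor
  · rintro ⟨h, rfl⟩ i hi
    by_cases hij : i = j
    · subst hij; simp
    · rw [Function.update_of_ne hij]; exact h i ⟨hij, hi⟩
  · intro h
    refine ⟨fun i hi => ?_, ?_⟩
    · have := h i hi.2
      rwa [Function.update_of_ne hi.1] at this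
    · simpa using h j hj

/-! ### Local energies -/

variable (M) in
/-- The sum of the potentials of the hyperedges containing `j` after `j` is put in state `c`. -/
noncomputable def localEnergy (j : V) (c : Fin (M.k j)) (x : M.Config) : ℝ :=
  ∑ h ∈ M.hyperedges with j ∈ h, M.potential h (h.restrict (Function.update x j c))

theorem restrict_update_of_notMem {h : Finset V} {j : V} (hj : j ∉ h) (x : M.Config)
    (c : Fin (M.k j)) : h.restrict (Function.update x j c) = h.restrict x := by
  ext1 i
  simp only [Finset.restrict]
  rw [Function.update_of_ne]
  rintro rfl
  exact hj i.2

theorem restrict_update_of_mem {h : Finset V} {j : V} (hj : j ∈ h) (x : M.Config)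
    (c : Fin (M.k j)) : h.restrict (Function.update x j c) =
      Function.update (β := fun i : h => Fin (M.k i)) (h.restrict x) ⟨j, hj⟩ c := by
  ext1 i
  by_cases hij : i = ⟨j, hj⟩
  · subst hij; simp [Finset.restrict]
  · rw [Function.update_of_ne hij]
    simp only [Finset.restrict]
    rw [Function.update_of_ne]
    intro h'
    exact hij (Subtype.ext h')

theorem energy_update (j : V) (c : Fin (M.k j)) (x : M.Config) :
    M.energy (Function.update x j c) = M.localEnergy j c x +
      ∑ h ∈ M.hyperedges with j ∉ h, M.potential h (h.restrict x) := by
  rw [energy, localEnergy, ← Finset.sum_filter_add_sum_filter_not M.hyperedges (fun h => j ∈ h)]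
  congr 1
  refine Finset.sum_congr rfl fun h hh => ?_
  rw [restrict_update_of_notMem (Finset.mem_filter.1 hh).2]

theorem localEnergy_update (j : V) (b c : Fin (M.k j)) (x : M.Config) :
    M.localEnergy j c (Function.update x j b) = M.localEnergy j c x := by
  simp [localEnergy]

theorem abs_potential_le (h : Finset V) (a : M.PartialConfig h) :
    |M.potential h a| ≤ M.maxEntry h :=
  le_ciSup (f := fun a : M.PartialConfig h => |M.potential h a|) (Set.finite_range _).bddAbove a

theorem maxEntry_nonneg (h : Finset V) : 0 ≤ M.maxEntry h :=
  Real.iSup_nonneg fun _ => abs_nonneg _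

theorem sum_maxEntry_le_gamma (v : V) :
    ∑ h ∈ M.hyperedges with v ∈ h, M.maxEntry h ≤ M.gamma :=
  le_ciSup (f := fun v : V => ∑ h ∈ M.hyperedges with v ∈ h, M.maxEntry h)
    (Set.finite_range _).bddAbove v

theorem abs_localEnergy_le (j : V) (c : Fin (M.k j)) (x : M.Config) :
    |M.localEnergy j c x| ≤ M.gamma :=
  (Finset.abs_sum_le_sum_abs _ _).trans
    ((Finset.sum_le_sum fun h _ => abs_potential_le h _).trans (sum_maxEntry_le_gamma j))

theorem sum_potential_update (hM : M.IsCanonical) {h : Finset V} {i : V} (hi : i ∈ h)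
    (x : M.Config) :
    ∑ c : Fin (M.k i), M.potential h (h.restrict (Function.update x i c)) = 0 := by
  simp only [restrict_update_of_mem hi]
  exact hM h ⟨i, hi⟩ (h.restrict x)

theorem sum_localEnergy (hM : M.IsCanonical) (j : V) (x : M.Config) :
    ∑ c, M.localEnergy j c x = 0 := by
  simp only [localEnergy]
  rw [Finset.sum_comm]
  exact Finset.sum_eq_zero fun h hh => sum_potential_update hM (Finset.mem_filter.1 hh).2 x

/-! ### Conditional probabilities of one vertex given all others -/

variable (M) in
/-- The probability that `X_j = c` given the states `x` of the other vertices. -/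
noncomputable def softmax (j : V) (c : Fin (M.k j)) (x : M.Config) : ℝ :=
  Real.exp (M.localEnergy j c x) / ∑ b, Real.exp (M.localEnergy j b x)

theorem sum_exp_localEnergy_pos (j : V) (x : M.Config) :
    0 < ∑ b, Real.exp (M.localEnergy j b x) :=
  Finset.sum_pos (fun _ _ => Real.exp_pos _) Finset.univ_nonempty

theorem softmax_update (j : V) (b c : Fin (M.k j)) (x : M.Config) :
    M.softmax j c (Function.update x j b) = M.softmax j c x := by
  simp only [softmax, localEnergy_update]

theorem pmf_update (j : V) (c : Fin (M.k j)) (x : M.Config) :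
    M.pmf (Function.update x j c) = M.softmax j c x * ∑ b, M.pmf (Function.update x j b) := by
  simp only [pmf, energy_update, softmax, add_sub_assoc, Real.exp_add, ← Finset.sum_mul]
  have := (M.sum_exp_localEnergy_pos j x).ne'
  field_simp

theorem delta_pos {K : ℕ} (hK : 0 < K) : 0 < M.delta K := by
  unfold delta; positivity

theorem gamma_nonneg : 0 ≤ M.gamma :=
  Real.iSup_nonneg fun _ => Finset.sum_nonneg fun _ _ => maxEntry_nonneg _

theorem delta_le_one (K : ℕ) : M.delta K ≤ 1 := by
  have h1 : Real.exp (-2 * M.gamma) ≤ 1 := Real.exp_le_one_iff.2 (by linarith [M.gamma_nonneg])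
  have h2 : 1 / (K : ℝ) ≤ 1 := by
    rcases Nat.eq_zero_or_pos K with rfl | h
    · simp
    · rw [div_le_one (by exact_mod_cast h)]; exact_mod_cast h
  have h3 : 0 ≤ 1 / (K : ℝ) := by positivity
  unfold delta
  nlinarith [Real.exp_pos (-2 * M.gamma)]

/-- The numerator is at least `exp (-γ)`, and the denominator has at most `K` terms, each at most
`exp γ`. -/
theorem delta_le_softmax {K : ℕ} (hK : ∀ i, M.k i ≤ K) (j : V) (c : Fin (M.k j)) (x : M.Config) :
    M.delta K ≤ M.softmax j c x := by
  have hK0 : (0 : ℝ) < K := by exact_mod_cast (M.k_pos j).trans_le (hK j)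
  rw [softmax, le_div_iff₀ (sum_exp_localEnergy_pos j x)]
  have hsum : ∑ b, Real.exp (M.localEnergy j b x) ≤ K * Real.exp M.gamma := by
    calc ∑ b, Real.exp (M.localEnergy j b x) ≤ ∑ _b : Fin (M.k j), Real.exp M.gamma :=
          Finset.sum_le_sum fun b _ =>
            Real.exp_le_exp.2 ((le_abs_self _).trans (abs_localEnergy_le j b x))
      _ = M.k j * Real.exp M.gamma := by simp
      _ ≤ K * Real.exp M.gamma := by
          gcongr
          exact hK j
  calc M.delta K * ∑ b, Real.exp (M.localEnergy j b x)
      ≤ M.delta K * (K * Real.exp M.gamma) :=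
        mul_le_mul_of_nonneg_left hsum (by unfold delta; positivity)
    _ = Real.exp (-M.gamma) := by
        rw [delta]
        field_simp
        rw [← Real.exp_add]; congr 1; ring
    _ ≤ _ := Real.exp_le_exp.2 (neg_le_of_abs_le (abs_localEnergy_le j c x))

/-- Given the other vertices, each state of `j` has probability at least `δ`, so resampling `X_j`
from its conditional law dominates `δ` times the sum over its states. -/
theorem delta_mul_sum_pmf_le {K : ℕ} (hK : ∀ i, M.k i ≤ K) (j : V) {H : M.Config → ℝ}
    (hH : ∀ x, 0 ≤ H x) :
    M.delta K * ∑ x, M.pmf x * ∑ c, H (Function.update x j c) ≤ ∑ x, M.pmf x * H x := by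
  have hk := M.natCast_k_pos j
  -- The factor `k j` allows coordinate `j` to be resampled uniformly on both sides.
  refine le_of_mul_le_mul_left ?_ hk
  rw [mul_left_comm, ← sum_sum_update j, ← sum_sum_update j, Finset.mul_sum]
  refine Finset.sum_le_sum fun x _ => ?_
  simp only [Function.update_idem]
  rw [← Finset.sum_mul, Finset.mul_sum, Finset.mul_sum]
  refine Finset.sum_le_sum fun c _ => ?_
  rw [pmf_update j c x, ← mul_assoc]
  refine mul_le_mul_of_nonneg_right (mul_le_mul_of_nonneg_right (delta_le_softmax hK j c x) ?_)
    (hH _)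
  exact Finset.sum_nonneg fun b _ => (M.pmf_pos _).le

theorem delta_pow_mul_sum_pmf_le {K : ℕ} (hK : ∀ i, M.k i ≤ K) (A : Finset V) {H : M.Config → ℝ}
    (hH : ∀ x, 0 ≤ H x) :
    M.delta K ^ A.card * ∑ x, M.pmf x * ∑ z ∈ M.cyl A x, H z ≤ ∑ x, M.pmf x * H x := by
  induction A using Finset.induction_on with
  | empty => simp [cyl_empty]
  | insert j A hj ih =>
    refine le_trans ?_ ih
    rw [Finset.card_insert_of_notMem hj, pow_succ, mul_assoc]
    have hδ : 0 ≤ M.delta K := by unfold delta; positivity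
    refine mul_le_mul_of_nonneg_left ?_ (pow_nonneg hδ _)
    simp only [sum_cyl_insert _ hj]
    exact delta_mul_sum_pmf_le hK j (H := fun x => ∑ z ∈ M.cyl A x, H z)
      fun x => Finset.sum_nonneg fun z _ => hH z

variable (M)

/-! ### Conditional means and covariances -/

/-- The conditional mean of `f` given the event `B`. -/
noncomputable def condMean (B : Set M.Config) (f : M.Config → ℝ) : ℝ :=
  (∑ x, B.indicator M.pmf x * f x) / M.prob B

/-- The conditional covariance of `f` and `g` given the event `B`. -/
noncomputable def condCov (B : Set M.Config) (f g : M.Config → ℝ) : ℝ :=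
  M.condMean B (fun x => f x * g x) - M.condMean B f * M.condMean B g

variable {M}

theorem prob_nonneg (A : Set M.Config) : 0 ≤ M.prob A :=
  Finset.sum_nonneg fun x _ => Set.indicator_nonneg (fun x _ => (M.pmf_pos x).le) x

theorem prob_pos_of_mem {A : Set M.Config} {x : M.Config} (hx : x ∈ A) : 0 < M.prob A := by
  refine Finset.sum_pos' (fun x _ => Set.indicator_nonneg (fun x _ => (M.pmf_pos x).le) x)
    ⟨x, Finset.mem_univ x, ?_⟩
  rw [Set.indicator_of_mem hx]
  exact M.pmf_pos x

theorem prob_setEvent_pos (S : Finset V) (s : M.PartialConfig S) : 0 < M.prob (M.setEvent S s) := by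
  refine prob_pos_of_mem
    (x := fun i => if h : i ∈ S then s ⟨i, h⟩ else ⟨0, M.k_pos i⟩) ?_
  ext1 i
  simp [Finset.restrict]

theorem prob_mul_condMean {B : Set M.Config} (hB : 0 < M.prob B) (f : M.Config → ℝ) :
    M.prob B * M.condMean B f = ∑ x, B.indicator M.pmf x * f x :=
  mul_div_cancel₀ _ hB.ne'

theorem condMean_congr {B : Set M.Config} {f g : M.Config → ℝ} (h : ∀ x ∈ B, f x = g x) :
    M.condMean B f = M.condMean B g := by
  unfold condMean
  congr 1
  refine Finset.sum_congr rfl fun x _ => ?_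
  by_cases hx : x ∈ B
  · rw [h x hx]
  · simp [hx]

theorem condMean_sum {ι : Type*} (t : Finset ι) (B : Set M.Config) (f : ι → M.Config → ℝ) :
    M.condMean B (fun x => ∑ i ∈ t, f i x) = ∑ i ∈ t, M.condMean B (f i) := by
  simp only [condMean, Finset.mul_sum, ← Finset.sum_div]
  rw [Finset.sum_comm]

theorem condMean_const_mul (B : Set M.Config) (c : ℝ) (f : M.Config → ℝ) :
    M.condMean B (fun x => c * f x) = c * M.condMean B f := by
  simp only [condMean, ← mul_div_assoc, Finset.mul_sum, mul_left_comm]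

theorem condMean_one {B : Set M.Config} (hB : 0 < M.prob B) : M.condMean B (fun _ => 1) = 1 := by
  simp only [condMean, mul_one]
  exact div_self hB.ne'

theorem condProb_eq_condMean (A B : Set M.Config) :
    M.condProb A B = M.condMean B (A.indicator 1) := by
  unfold condProb condMean prob
  congr 1
  refine Finset.sum_congr rfl fun x _ => ?_
  by_cases hA : x ∈ A <;> by_cases hB : x ∈ B <;> simp [hA, hB]

theorem condCov_sum_left {ι : Type*} (t : Finset ι) (B : Set M.Config) (f : ι → M.Config → ℝ)
    (g : M.Config → ℝ) :
    M.condCov B (fun x => ∑ i ∈ t, f i x) g = ∑ i ∈ t, M.condCov B (f i) g := by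
  simp only [condCov, Finset.sum_mul, condMean_sum, Finset.sum_sub_distrib]

theorem condCov_const_mul_left (B : Set M.Config) (c : ℝ) (f g : M.Config → ℝ) :
    M.condCov B (fun x => c * f x) g = c * M.condCov B f g := by
  simp only [condCov, mul_assoc, condMean_const_mul, mul_sub]

theorem condCov_congr_left {B : Set M.Config} {f f' : M.Config → ℝ} (h : ∀ x ∈ B, f x = f' x)
    (g : M.Config → ℝ) : M.condCov B f g = M.condCov B f' g := by
  rw [condCov, condCov, condMean_congr h, condMean_congr fun x hx => by rw [h x hx]]

theorem condCov_const_left {B : Set M.Config} (hB : 0 < M.prob B) (c : ℝ) (g : M.Config → ℝ) :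
    M.condCov B (fun _ => c) g = 0 := by
  have h : M.condMean B (fun _ => c) = c := by
    have := M.condMean_const_mul B c fun _ => 1
    rwa [condMean_one hB, mul_one] at this
  rw [condCov, condMean_const_mul, h, sub_self]

/-- Two independent copies express the covariance through differences, so that monotonicity can be
applied to each pair of configurations. -/
theorem condCov_eq_sum_sum {B : Set M.Config} (hB : 0 < M.prob B) (f g : M.Config → ℝ) :
    M.condCov B f g = 1 / 2 * ∑ x, ∑ y, (B.indicator M.pmf x / M.prob B) *
      (B.indicator M.pmf y / M.prob B) * ((f x - f y) * (g x - g y)) := by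
  have hm : ∀ f : M.Config → ℝ,
      M.condMean B f = ∑ x, (B.indicator M.pmf x / M.prob B) * f x := fun f => by
    simp only [condMean, Finset.sum_div, div_mul_eq_mul_div]
  have h1 : ∑ x, B.indicator M.pmf x / M.prob B = 1 := by
    simpa [hm] using M.condMean_one hB
  rw [condCov, hm, hm f, hm g]
  generalize hw : (fun x => B.indicator M.pmf x / M.prob B) = w
  have hw' : ∀ x, B.indicator M.pmf x / M.prob B = w x := fun x => congrFun hw x
  simp only [hw'] at h1 ⊢
  have e : ∀ x y, w x * w y * ((f x - f y) * (g x - g y)) =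
      w x * (f x * g x) * w y - (w x * f x) * (w y * g y) - (w x * g x) * (w y * f y)
        + w x * (w y * (f y * g y)) := fun x y => by ring
  simp only [e, Finset.sum_add_distrib, Finset.sum_sub_distrib, ← Finset.mul_sum, ← Finset.sum_mul,
    h1]
  ring

theorem condCov_self_eq {B : Set M.Config} (hB : 0 < M.prob B) (f : M.Config → ℝ) :
    M.condCov B f f = M.condMean B fun x => (f x - M.condMean B f) ^ 2 := by
  have h1 := M.condMean_one hB
  set m := M.condMean B f with hm
  have e : ∀ x, B.indicator M.pmf x * (f x - m) ^ 2 = B.indicator M.pmf x * (f x * f x)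
      - 2 * m * (B.indicator M.pmf x * f x) + m ^ 2 * (B.indicator M.pmf x * 1) :=
    fun x => by ring
  have : M.condMean B (fun x => (f x - m) ^ 2) = M.condMean B (fun x => f x * f x)
      - 2 * m * M.condMean B f + m ^ 2 * M.condMean B fun _ => 1 := by
    simp only [condMean, e, Finset.sum_add_distrib, Finset.sum_sub_distrib, ← Finset.mul_sum]
    ring
  rw [this, h1, condCov, ← hm]
  ring

theorem sum_sum_indicator_setEvent (S : Finset V) (H : M.PartialConfig S → M.Config → ℝ) :
    ∑ s, ∑ x, (M.setEvent S s).indicator M.pmf x * H s x =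
      ∑ x, M.pmf x * H (S.restrict x) x := by
  rw [Finset.sum_comm]
  refine Finset.sum_congr rfl fun x _ => ?_
  rw [Finset.sum_eq_single (S.restrict x)]
  · simp [setEvent]
  · intro s _ hs
    simp [setEvent, hs.symm]
  · simp

theorem sum_prob_setEvent (S : Finset V) : ∑ s, M.prob (M.setEvent S s) = 1 := by
  have := sum_sum_indicator_setEvent (M := M) S fun _ _ => 1
  simpa [prob, sum_pmf] using this

theorem indicator_setEvent_update {S : Finset V} {u : V} (hu : u ∉ S) (s : M.PartialConfig S)
    (f : M.Config → ℝ) (x : M.Config) (c : Fin (M.k u)) :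
    (M.setEvent S s).indicator f (Function.update x u c) =
      (M.setEvent S s).indicator 1 x * f (Function.update x u c) := by
  simp [Set.indicator_apply, setEvent, restrict_update_of_notMem hu]

/-- Tower property: neither `f` nor the event `X_S = s` depends on `X_u`, so the indicator can be
averaged over `X_u` given the rest. -/
theorem condMean_mul_nodeEvent {S : Finset V} {u : V} (hu : u ∉ S) (s : M.PartialConfig S)
    {f : M.Config → ℝ} (hf : ∀ x c, f (Function.update x u c) = f x) (R : Fin (M.k u)) :
    M.condMean (M.setEvent S s) (fun x => f x * (M.nodeEvent u R).indicator 1 x) =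
      M.condMean (M.setEvent S s) (fun x => f x * M.softmax u R x) := by
  unfold condMean
  congr 1
  refine mul_left_cancel₀ (natCast_k_pos (M := M) u).ne' ?_
  rw [← sum_sum_update u, ← sum_sum_update u]
  refine Finset.sum_congr rfl fun x _ => ?_
  simp only [indicator_setEvent_update hu, hf, softmax_update, ← Finset.sum_mul, ← Finset.mul_sum]
  rw [Finset.sum_eq_single R]
  · rw [pmf_update u R x]
    simp [nodeEvent]
    ring
  · intro c _ hc
    simp [nodeEvent, hc]
  · simp

theorem condCov_nodeEvent {S : Finset V} {u : V} (hu : u ∉ S) (s : M.PartialConfig S)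
    {f : M.Config → ℝ} (hf : ∀ x c, f (Function.update x u c) = f x) (R : Fin (M.k u)) :
    M.condCov (M.setEvent S s) f ((M.nodeEvent u R).indicator 1) =
      M.condCov (M.setEvent S s) f (M.softmax u R) := by
  have h := condMean_mul_nodeEvent hu s (f := fun _ => 1) (fun _ _ => rfl) R
  simp only [one_mul] at h
  rw [condCov, condCov, condMean_mul_nodeEvent hu s hf, h]

end MarkovRandomField

/-! ### Strong monotonicity of the softmax map -/

/-- Follows from `1 + t ≤ exp t`, with the roles of `p` and `q` exchanged when `t ≤ 0`. -/
theorem mul_sq_le_mul_sub_of_eq_mul_exp {m p q t : ℝ} (hp : m ≤ p) (hq : m ≤ q) (hp0 : 0 ≤ p)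
    (hq0 : 0 ≤ q) (h : p = q * Real.exp t) : m * t ^ 2 ≤ t * (p - q) := by
  rcases le_total 0 t with ht | ht
  · have h1 : q * t ≤ p - q := by nlinarith [Real.add_one_le_exp t]
    nlinarith [mul_le_mul_of_nonneg_left h1 ht, mul_le_mul_of_nonneg_right hq (sq_nonneg t)]
  · have h' : q = p * Real.exp (-t) := by
      rw [h, mul_assoc, ← Real.exp_add]; simp
    have h1 : p * (-t) ≤ q - p := by nlinarith [Real.add_one_le_exp (-t)]
    nlinarith [mul_le_mul_of_nonneg_left h1 (neg_nonneg.2 ht),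
      mul_le_mul_of_nonneg_right hp (sq_nonneg t)]

/-- Comparing pairs of indices removes the normalizations: with `c = a - b`, the ratio of `p i * q
j` to `q i * p j` is `exp (c i - c j)`. Summing the two-point inequality over all pairs gives both
sides, each twice; the cross terms on the left vanish because `c` sums to zero. -/
theorem sum_sub_mul_softmax_sub_ge {ι : Type*} [Fintype ι] (a b p q : ι → ℝ) (Za Zb δ : ℝ)
    (hδ : 0 ≤ δ) (hp : ∀ i, p i = Real.exp (a i) / Za) (hq : ∀ i, q i = Real.exp (b i) / Zb)
    (hp1 : ∑ i, p i = 1) (hq1 : ∑ i, q i = 1) (hpδ : ∀ i, δ ≤ p i) (hqδ : ∀ i, δ ≤ q i)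
    (hab : ∑ i, (a i - b i) = 0) :
    δ ^ 2 * Fintype.card ι * ∑ i, (a i - b i) ^ 2 ≤ ∑ i, (a i - b i) * (p i - q i) := by
  set c : ι → ℝ := fun i => a i - b i with hc
  have key : ∀ i j, δ ^ 2 * (c i - c j) ^ 2 ≤ (c i - c j) * (p i * q j - q i * p j) := by
    intro i j
    have hpos : ∀ i j, δ ^ 2 ≤ p i * q j := fun i j => by
      rw [sq]; exact mul_le_mul (hpδ i) (hqδ j) hδ (hδ.trans (hpδ i))
    refine mul_sq_le_mul_sub_of_eq_mul_exp (hpos i j) (mul_comm (p j) (q i) ▸ hpos j i)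
      ((sq_nonneg δ).trans (hpos i j)) ((sq_nonneg δ).trans (mul_comm (p j) (q i) ▸ hpos j i)) ?_
    have hexp : Real.exp (a i) * Real.exp (b j) =
        Real.exp (b i) * Real.exp (a j) * Real.exp (c i - c j) := by
      rw [← Real.exp_add, ← Real.exp_add, ← Real.exp_add]; congr 1; simp only [hc]; ring
    rw [hp i, hq j, hq i, hp j, div_mul_div_comm, hexp]
    ring
  have lhs : ∑ i, ∑ j, δ ^ 2 * (c i - c j) ^ 2 =
      2 * (δ ^ 2 * Fintype.card ι * ∑ i, c i ^ 2) := by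
    have e : ∀ i j, δ ^ 2 * (c i - c j) ^ 2 =
        δ ^ 2 * c i ^ 2 - 2 * δ ^ 2 * c i * c j + δ ^ 2 * c j ^ 2 := fun i j => by ring
    simp only [e, Finset.sum_add_distrib, Finset.sum_sub_distrib, ← Finset.mul_sum, hab,
      Finset.sum_const, Finset.card_univ, nsmul_eq_mul, mul_zero]
    ring
  have rhs : ∑ i, ∑ j, (c i - c j) * (p i * q j - q i * p j) = 2 * ∑ i, c i * (p i - q i) := by
    have e : ∀ i j, (c i - c j) * (p i * q j - q i * p j) =
        c i * p i * q j - c i * q i * p j - p i * (c j * q j) + q i * (c j * p j) :=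
      fun i j => by ring
    simp only [e, Finset.sum_add_distrib, Finset.sum_sub_distrib, ← Finset.mul_sum,
      ← Finset.sum_mul, hp1, hq1, mul_sub]
    ring
  have := Finset.sum_le_sum fun i (_ : i ∈ Finset.univ) =>
    Finset.sum_le_sum fun j (_ : j ∈ Finset.univ) => key i j
  rw [lhs, rhs] at this
  linarith

namespace MarkovRandomField

variable {V : Type*} [Fintype V] [DecidableEq V] {r : ℕ} {M : MarkovRandomField V r}

theorem sum_softmax (u : V) (x : M.Config) : ∑ R, M.softmax u R x = 1 := by
  simp only [softmax, ← Finset.sum_div]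
  exact div_self (sum_exp_localEnergy_pos u x).ne'

theorem sum_condCov_nodeEvent_ge (hM : M.IsCanonical) {K : ℕ} (hK : ∀ i, M.k i ≤ K)
    {S : Finset V} {u : V} (hu : u ∉ S) (s : M.PartialConfig S) :
    M.delta K ^ 2 * M.k u *
        ∑ R, M.condCov (M.setEvent S s) (M.localEnergy u R) (M.localEnergy u R) ≤
      ∑ R, M.condCov (M.setEvent S s) (M.localEnergy u R) ((M.nodeEvent u R).indicator 1) := by
  have hB := M.prob_setEvent_pos S s
  have hδ : 0 ≤ M.delta K := by unfold delta; positivity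
  simp only [condCov_nodeEvent hu s (fun x c => localEnergy_update u c _ x)]
  simp only [condCov_eq_sum_sum hB, ← Finset.mul_sum]
  rw [mul_left_comm]
  refine mul_le_mul_of_nonneg_left ?_ (by norm_num)
  rw [Finset.sum_comm, Finset.mul_sum, Finset.sum_comm (s := (Finset.univ : Finset (Fin (M.k u))))]
  refine Finset.sum_le_sum fun x _ => ?_
  rw [Finset.sum_comm, Finset.mul_sum, Finset.sum_comm (s := (Finset.univ : Finset (Fin (M.k u))))]
  refine Finset.sum_le_sum fun y _ => ?_
  rw [← Finset.mul_sum, ← Finset.mul_sum, mul_left_comm]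
  have hw : ∀ x, 0 ≤ (M.setEvent S s).indicator M.pmf x / M.prob (M.setEvent S s) := fun x =>
    div_nonneg (Set.indicator_nonneg (fun x _ => (M.pmf_pos x).le) x) hB.le
  refine mul_le_mul_of_nonneg_left ?_ (mul_nonneg (hw x) (hw y))
  have := sum_sub_mul_softmax_sub_ge (fun R => M.localEnergy u R x) (fun R => M.localEnergy u R y)
    (fun R => M.softmax u R x) (fun R => M.softmax u R y) _ _ (M.delta K) hδ
    (fun _ => rfl) (fun _ => rfl) (sum_softmax u x) (sum_softmax u y)
    (fun R => delta_le_softmax hK u R x) (fun R => delta_le_softmax hK u R y)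
    (by rw [Finset.sum_sub_distrib, sum_localEnergy hM, sum_localEnergy hM, sub_self])
  simpa [sq] using this

/-! ### A lower bound for the conditional variance of the local energy -/

theorem erase_subset_neighborFinset {h : Finset V} (hh : h ∈ M.hyperedges) {u : V} (hu : u ∈ h) :
    h.erase u ⊆ M.graph.neighborFinset u := by
  intro i hi
  rw [Finset.mem_erase] at hi
  rw [SimpleGraph.mem_neighborFinset]
  exact ⟨hi.1.symm, h, hh, hu, hi.2⟩

/-- Tensors of distinct hyperedges are orthogonal, so that a single tensor bounds from below the
square of the local energy up to a function that does not depend on one of its vertices. -/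
theorem sum_cyl_sq_potential_le (hM : M.IsCanonical) {h : Finset V} (hh : h ∈ M.hyperedges)
    {u i : V} (hu : u ∈ h) (hi : i ∈ h) (hiu : i ≠ u) {g : M.Config → ℝ}
    (hg : ∀ x c, g (Function.update x i c) = g x) (R : Fin (M.k u)) (x : M.Config) :
    ∑ z ∈ M.cyl (M.graph.neighborFinset u) x,
        M.potential h (h.restrict (Function.update z u R)) ^ 2 ≤
      ∑ z ∈ M.cyl (M.graph.neighborFinset u) x, (M.localEnergy u R z - g z) ^ 2 := by
  set ψ : Finset V → M.Config → ℝ := fun h z =>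
    M.potential h (h.restrict (Function.update z u R)) with hψ
  have hsum : ∀ (h : Finset V) (j : V), j ∈ h → j ≠ u → ∀ z,
      ∑ c : Fin (M.k j), ψ h (Function.update z j c) = 0 := by
    intro h j hj hju z
    simp only [hψ]
    rw [← sum_potential_update hM hj (Function.update z u R)]
    refine Finset.sum_congr rfl fun c _ => ?_
    rw [Function.update_comm hju]
  have hconst : ∀ (h : Finset V) (j : V), j ∉ h → j ≠ u → ∀ z (c : Fin (M.k j)),
      ψ h (Function.update z j c) = ψ h z := by
    intro h j hj hju z c
    simp only [hψ]
    rw [Function.update_comm hju, restrict_update_of_notMem hj]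
  have hnb : ∀ h ∈ M.hyperedges, u ∈ h → ∀ j ∈ h, j ≠ u → j ∈ M.graph.neighborFinset u :=
    fun h hh hu j hj hju => erase_subset_neighborFinset hh hu (Finset.mem_erase.2 ⟨hju, hj⟩)
  have orth : ∀ h' ∈ (M.hyperedges.filter (u ∈ ·)).erase h,
      ∑ z ∈ M.cyl (M.graph.neighborFinset u) x, ψ h z * ψ h' z = 0 := by
    intro h' hh'
    simp only [Finset.mem_erase, Finset.mem_filter] at hh'
    obtain ⟨hne, hh', hu'⟩ := hh'
    -- Distinct hyperedges differ in a vertex `j`, and `j ≠ u` because both contain `u`. Summing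
    -- over the states of `j` kills the tensor containing it, while the other is constant.
    by_cases hsub : h ⊆ h'
    · obtain ⟨j, hj', hj⟩ := Finset.exists_of_ssubset (hsub.ssubset_of_ne hne.symm)
      have hju : j ≠ u := by rintro rfl; exact hj hu
      simp only [mul_comm (ψ h _)]
      exact sum_cyl_mul_eq_zero x (hnb h' hh' hu' j hj' hju) (hsum h' j hj' hju)
        (hconst h j hj hju)
    · obtain ⟨j, hj, hj'⟩ := Finset.not_subset.1 hsub
      have hju : j ≠ u := by rintro rfl; exact hj' hu'
      exact sum_cyl_mul_eq_zero x (hnb h hh hu j hj hju) (hsum h j hj hju) (hconst h' j hj' hju)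
  have orthg : ∑ z ∈ M.cyl (M.graph.neighborFinset u) x, ψ h z * g z = 0 :=
    sum_cyl_mul_eq_zero x (hnb h hh hu i hi hiu) (hsum h i hi hiu) hg
  have hE : ∀ z, M.localEnergy u R z =
      ψ h z + ∑ h' ∈ (M.hyperedges.filter (u ∈ ·)).erase h, ψ h' z := fun z => by
    rw [localEnergy, ← Finset.add_sum_erase _ _ (Finset.mem_filter.2 ⟨hh, hu⟩)]
  have hcross : ∑ z ∈ M.cyl (M.graph.neighborFinset u) x,
      ψ h z * (∑ h' ∈ (M.hyperedges.filter (u ∈ ·)).erase h, ψ h' z - g z) = 0 := by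
    simp only [mul_sub, Finset.sum_sub_distrib, orthg, Finset.mul_sum, sub_zero]
    rw [Finset.sum_comm]
    exact Finset.sum_eq_zero orth
  calc ∑ z ∈ M.cyl (M.graph.neighborFinset u) x, ψ h z ^ 2
      = ∑ z ∈ M.cyl (M.graph.neighborFinset u) x, (ψ h z ^ 2 + 2 * (ψ h z *
          (∑ h' ∈ (M.hyperedges.filter (u ∈ ·)).erase h, ψ h' z - g z))) := by
        rw [Finset.sum_add_distrib, ← Finset.mul_sum, hcross, mul_zero, add_zero]
    _ ≤ _ := Finset.sum_le_sum fun z _ => by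
        rw [hE z]
        nlinarith [sq_nonneg (∑ h' ∈ (M.hyperedges.filter (u ∈ ·)).erase h, ψ h' z - g z)]

theorem exists_mem_cyl_restrict_update_eq {h : Finset V} (hh : h ∈ M.hyperedges) {u : V}
    (hu : u ∈ h) (a : M.PartialConfig h) (x : M.Config) :
    ∃ z ∈ M.cyl (M.graph.neighborFinset u) x,
      h.restrict (Function.update z u (a ⟨u, hu⟩)) = a := by
  refine ⟨fun i => if hi : i ∈ h ∧ i ≠ u then a ⟨i, hi.1⟩ else x i, ?_, ?_⟩
  · rw [mem_cyl]
    intro i hi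
    rw [dif_neg]
    exact fun h' => hi (erase_subset_neighborFinset hh hu (Finset.mem_erase.2 ⟨h'.2, h'.1⟩))
  · ext1 ⟨i, hi⟩
    by_cases hiu : i = u
    · subst hiu; simp [Finset.restrict]
    · simp only [Finset.restrict]
      rw [Function.update_of_ne hiu, dif_pos ⟨hi, hiu⟩]

/-- The conditional mean is a function of `X_S` alone, hence constant in `X_i`; subtracting it
cannot cancel the tensor of `h`. The remaining vertices of `h` are neighbors of `u`, so each
cylinder over `Γ(u)` meets the entry `a`. -/
theorem sum_prob_mul_condVar_localEnergy_ge (hM : M.IsCanonical) {K : ℕ} (hK : ∀ i, M.k i ≤ K)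
    {S h : Finset V} (hh : h ∈ M.hyperedges) {u i : V} (hu : u ∈ h) (hi : i ∈ h) (hiu : i ≠ u)
    (hiS : i ∉ S) (a : M.PartialConfig h) :
    M.delta K ^ M.graph.degree u * M.potential h a ^ 2 ≤
      ∑ s, M.prob (M.setEvent S s) * M.condCov (M.setEvent S s)
        (M.localEnergy u (a ⟨u, hu⟩)) (M.localEnergy u (a ⟨u, hu⟩)) := by
  set R := a ⟨u, hu⟩ with hR
  have hδ : 0 ≤ M.delta K := by unfold delta; positivity
  simp only [condCov_self_eq (M.prob_setEvent_pos S _), prob_mul_condMean (M.prob_setEvent_pos S _)]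
  rw [sum_sum_indicator_setEvent S fun s x =>
    (M.localEnergy u R x - M.condMean (M.setEvent S s) (M.localEnergy u R)) ^ 2]
  refine le_trans ?_ (delta_pow_mul_sum_pmf_le hK (M.graph.neighborFinset u)
    fun x => sq_nonneg _)
  rw [SimpleGraph.card_neighborFinset_eq_degree]
  refine mul_le_mul_of_nonneg_left ?_ (pow_nonneg hδ _)
  calc M.potential h a ^ 2 = ∑ x, M.pmf x * M.potential h a ^ 2 := by
        rw [← Finset.sum_mul, sum_pmf, one_mul]
    _ ≤ _ := Finset.sum_le_sum fun x _ => mul_le_mul_of_nonneg_left ?_ (M.pmf_pos x).le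
  obtain ⟨z, hz, hza⟩ := exists_mem_cyl_restrict_update_eq hh hu a x
  refine le_trans ?_ (sum_cyl_sq_potential_le hM hh hu hi hiu
    (g := fun x => M.condMean (M.setEvent S (S.restrict x)) (M.localEnergy u R))
    (fun x c => by rw [restrict_update_of_notMem hiS]) R x)
  rw [← hza]
  exact Finset.single_le_sum
    (f := fun z => M.potential h (h.restrict (Function.update z u R)) ^ 2)
    (fun z _ => sq_nonneg _) hz

end MarkovRandomField

/-! ### Pinsker's inequality for finite distributions -/

theorem hasDerivAt_add_one_mul_log_sub {t : ℝ} (ht : 0 < t) :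
    HasDerivAt (fun t : ℝ => (t + 1) * Real.log t - 2 * (t - 1))
      (Real.log t + t⁻¹ - 1) t := by
  have h := (((hasDerivAt_id t).add_const 1).mul (Real.hasDerivAt_log ht.ne')).sub
    (((hasDerivAt_id t).sub_const 1).const_mul 2)
  refine h.congr_deriv ?_
  simp only [id]
  field_simp
  ring

theorem monotoneOn_add_one_mul_log_sub :
    MonotoneOn (fun t : ℝ => (t + 1) * Real.log t - 2 * (t - 1)) (Set.Ioi 0) := by
  refine monotoneOn_of_deriv_nonneg (convex_Ioi 0)
    (fun t ht => (hasDerivAt_add_one_mul_log_sub ht).continuousAt.continuousWithinAt)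
    (fun t ht => ?_) (fun t ht => ?_)
  · rw [interior_Ioi] at ht
    exact (hasDerivAt_add_one_mul_log_sub ht).differentiableAt.differentiableWithinAt
  · rw [interior_Ioi] at ht
    rw [(hasDerivAt_add_one_mul_log_sub ht).deriv]
    have := Real.one_sub_inv_le_log_of_pos ht
    linarith

/-- The difference of the two sides vanishes at `1`. Its derivative is four times the increasing
function of `monotoneOn_add_one_mul_log_sub`, which also vanishes at `1`, so `1` is the minimum. -/
theorem three_mul_sub_one_sq_le {t : ℝ} (ht : 0 < t) :
    3 * (t - 1) ^ 2 ≤ (2 * t + 4) * (t * Real.log t - t + 1) := by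
  set G : ℝ → ℝ := fun t => (2 * t + 4) * (t * Real.log t - t + 1) - 3 * (t - 1) ^ 2 with hG
  have hd : ∀ t : ℝ, 0 < t →
      HasDerivAt G (4 * ((t + 1) * Real.log t - 2 * (t - 1))) t := by
    intro t ht
    have h := ((((hasDerivAt_id t).const_mul 2).add_const 4).mul
      ((((hasDerivAt_id t).mul (Real.hasDerivAt_log ht.ne')).sub (hasDerivAt_id t)).add_const
        1)).sub ((((hasDerivAt_id t).sub_const 1).pow 2).const_mul 3)
    refine h.congr_deriv ?_
    simp only [Pi.mul_apply, Pi.sub_apply, id]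
    field_simp
    push_cast
    ring
  have hG1 : G 1 = 0 := by simp [hG]
  have key : G 1 ≤ G t := by
    rcases le_total 1 t with h | h
    · refine (monotoneOn_of_deriv_nonneg (convex_Ici 1)
        (fun s hs => (hd s (zero_lt_one.trans_le hs)).continuousAt.continuousWithinAt)
        (fun s hs => ?_) (fun s hs => ?_)) (Set.self_mem_Ici) h h
      · rw [interior_Ici] at hs
        exact (hd s (zero_lt_one.trans hs)).differentiableAt.differentiableWithinAt
      · rw [interior_Ici] at hs
        have hs0 : (0 : ℝ) < s := zero_lt_one.trans hs
        rw [(hd s hs0).deriv]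
        have := monotoneOn_add_one_mul_log_sub (Set.mem_Ioi.2 one_pos) hs0 (le_of_lt hs)
        simp only [Real.log_one] at this
        linarith
    · refine (antitoneOn_of_deriv_nonpos (convex_Ioc 0 1)
        (fun s hs => (hd s hs.1).continuousAt.continuousWithinAt)
        (fun s hs => ?_) (fun s hs => ?_)) ⟨ht, h⟩ ⟨one_pos, le_rfl⟩ h
      · rw [interior_Ioc] at hs
        exact (hd s hs.1).differentiableAt.differentiableWithinAt
      · rw [interior_Ioc] at hs
        rw [(hd s hs.1).deriv]
        have := monotoneOn_add_one_mul_log_sub (Set.mem_Ioi.2 hs.1) (Set.mem_Ioi.2 one_pos) hs.2.le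
        simp only [Real.log_one] at this
        linarith
  rw [hG1] at key
  simp only [hG] at key
  linarith

theorem three_mul_sub_sq_le_mul_log_div {p q : ℝ} (hp : 0 ≤ p) (hq : 0 ≤ q) (hpq : q = 0 → p = 0) :
    3 * (p - q) ^ 2 ≤ (2 * p + 4 * q) * (p * Real.log (p / q) - p + q) := by
  rcases hq.eq_or_lt with rfl | hq
  · simp [hpq rfl]
  rcases hp.eq_or_lt with rfl | hp
  · simp; nlinarith
  have h := mul_le_mul_of_nonneg_left (three_mul_sub_one_sq_le (div_pos hp hq)) (sq_nonneg q)
  have e1 : q ^ 2 * (3 * (p / q - 1) ^ 2) = 3 * (p - q) ^ 2 := by field_simp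
  have e2 : q ^ 2 * ((2 * (p / q) + 4) * (p / q * Real.log (p / q) - p / q + 1)) =
      (2 * p + 4 * q) * (p * Real.log (p / q) - p + q) := by
    generalize Real.log (p / q) = L
    field_simp
  rwa [e1, e2] at h

/-- Cauchy-Schwarz on the pointwise bound: the weights `(2 p + 4 q) / 3` sum to `2`, and the terms
`-p + q` cancel in total. -/
theorem sum_abs_sub_sq_le {ι : Type*} [Fintype ι] {p q : ι → ℝ} (hp : ∀ i, 0 ≤ p i)
    (hq : ∀ i, 0 ≤ q i) (hpq : ∀ i, q i = 0 → p i = 0) (hp1 : ∑ i, p i = 1)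
    (hq1 : ∑ i, q i = 1) :
    (∑ i, |p i - q i|) ^ 2 ≤ 2 * ∑ i, p i * Real.log (p i / q i) := by
  have hpt := fun i => three_mul_sub_sq_le_mul_log_div (hp i) (hq i) (hpq i)
  have hw : ∀ i, 0 ≤ 2 * p i + 4 * q i := fun i => by linarith [hp i, hq i]
  have hv : ∀ i, 0 ≤ p i * Real.log (p i / q i) - p i + q i := fun i => by
    rcases (hw i).eq_or_lt with h0 | h0
    · have h1 : p i = 0 := by linarith [hp i, hq i]
      have h2 : q i = 0 := by linarith [hp i, hq i]
      simp [h1, h2]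
    · exact nonneg_of_mul_nonneg_right ((by positivity : 0 ≤ 3 * (p i - q i) ^ 2).trans (hpt i)) h0
  have h := Finset.sum_sq_le_sum_mul_sum_of_sq_le_mul Finset.univ
    (r := fun i => |p i - q i|) (f := fun i => (2 * p i + 4 * q i) / 3)
    (g := fun i => p i * Real.log (p i / q i) - p i + q i)
    (fun i _ => div_nonneg (hw i) (by norm_num)) (fun i _ => hv i)
    (fun i _ => by rw [sq_abs]; linarith [hpt i])
  simp only [← Finset.sum_div, Finset.sum_add_distrib, Finset.sum_sub_distrib, ← Finset.mul_sum,
    hp1, hq1] at h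
  linarith

/-- Pinsker's inequality for a single atom. -/
theorem abs_sub_le_sqrt_sum_mul_log {ι : Type*} [Fintype ι] {p q : ι → ℝ}
    (hp : ∀ i, 0 ≤ p i) (hq : ∀ i, 0 ≤ q i) (hpq : ∀ i, q i = 0 → p i = 0)
    (hp1 : ∑ i, p i = 1) (hq1 : ∑ i, q i = 1) (j : ι) :
    |p j - q j| ≤ Real.sqrt (1 / 2 * ∑ i, p i * Real.log (p i / q i)) := by
  classical
  have h := sum_abs_sub_sq_le hp hq hpq hp1 hq1
  refine Real.le_sqrt_of_sq_le ?_
  have h0 : p j - q j + ∑ i ∈ Finset.univ.erase j, (p i - q i) = 0 := by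
    rw [Finset.add_sum_erase _ (fun i => p i - q i) (Finset.mem_univ j), Finset.sum_sub_distrib, hp1, hq1, sub_self]
  -- The other atoms must compensate the deviation at `j`, so it counts twice in the total.
  have h1 : 2 * |p j - q j| ≤ ∑ i, |p i - q i| := by
    rw [← Finset.add_sum_erase _ _ (Finset.mem_univ j)]
    have h2 := Finset.abs_sum_le_sum_abs (fun i => p i - q i) (Finset.univ.erase j)
    rw [← neg_eq_of_add_eq_zero_right h0, abs_neg] at h2
    linarith
  have h3 := pow_le_pow_left₀ (by positivity) h1 2
  linarith

namespace MarkovRandomField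

variable {V : Type*} [Fintype V] [DecidableEq V] {r : ℕ} {M : MarkovRandomField V r}

/-! ### Marginals of conditional probabilities and the information lower bound -/

theorem condMean_nonneg (B : Set M.Config) {f : M.Config → ℝ} (hf : ∀ x, 0 ≤ f x) :
    0 ≤ M.condMean B f :=
  div_nonneg (Finset.sum_nonneg fun x _ =>
    mul_nonneg (Set.indicator_nonneg (fun x _ => (M.pmf_pos x).le) x) (hf x)) (prob_nonneg B)

theorem condProb_nonneg (A B : Set M.Config) : 0 ≤ M.condProb A B :=
  div_nonneg (prob_nonneg _) (prob_nonneg _)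

theorem sum_indicator_setEvent (I : Finset V) (x : M.Config) (f : M.PartialConfig I → ℝ) :
    ∑ G, f G * (M.setEvent I G).indicator 1 x = f (I.restrict x) := by
  rw [Finset.sum_eq_single (I.restrict x)]
  · simp [setEvent]
  · intro G _ hG
    simp [setEvent, hG.symm]
  · simp

theorem sum_indicator_nodeEvent (u : V) (x : M.Config) :
    ∑ R, (M.nodeEvent u R).indicator (1 : M.Config → ℝ) x = 1 := by
  rw [Finset.sum_eq_single (x u)]
  · simp [nodeEvent]
  · intro R _ hR
    simp [nodeEvent, hR.symm]
  · simp

theorem sum_condProb_inter_setEvent (A B : Set M.Config) (I : Finset V) :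
    ∑ G, M.condProb (A ∩ M.setEvent I G) B = M.condProb A B := by
  simp only [condProb_eq_condMean, ← condMean_sum]
  refine condMean_congr fun x _ => ?_
  simp only [Set.inter_indicator_one, Pi.mul_apply]
  exact sum_indicator_setEvent I x fun _ => A.indicator 1 x

theorem sum_condProb_nodeEvent_inter (A B : Set M.Config) (u : V) :
    ∑ R, M.condProb (M.nodeEvent u R ∩ A) B = M.condProb A B := by
  simp only [condProb_eq_condMean, ← condMean_sum]
  refine condMean_congr fun x _ => ?_
  simp only [Set.inter_indicator_one, Pi.mul_apply]
  rw [← Finset.sum_mul, sum_indicator_nodeEvent, one_mul]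

theorem condProb_univ {B : Set M.Config} (hB : 0 < M.prob B) :
    M.condProb Set.univ B = 1 := by
  rw [condProb, Set.univ_inter, div_self hB.ne']

theorem abs_condProb_sub_le_sqrt_mutualInfoGiven (u : V) (I S : Finset V) (s : M.PartialConfig S)
    (R : Fin (M.k u)) (G : M.PartialConfig I) :
    |M.condProb (M.nodeEvent u R ∩ M.setEvent I G) (M.setEvent S s) -
        M.condProb (M.nodeEvent u R) (M.setEvent S s) *
          M.condProb (M.setEvent I G) (M.setEvent S s)| ≤
      Real.sqrt (1 / 2 * M.mutualInfoGiven u I S s) := by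
  have hB := M.prob_setEvent_pos S s
  have hR1 : ∑ R, M.condProb (M.nodeEvent u R) (M.setEvent S s) = 1 := by
    have := sum_condProb_nodeEvent_inter Set.univ (M.setEvent S s) u
    simpa only [Set.inter_univ, condProb_univ hB] using this
  have hG1 : ∑ G, M.condProb (M.setEvent I G) (M.setEvent S s) = 1 := by
    have := sum_condProb_inter_setEvent Set.univ (M.setEvent S s) I
    simpa only [Set.univ_inter, condProb_univ hB] using this
  have h := abs_sub_le_sqrt_sum_mul_log
    (p := fun x : Fin (M.k u) × M.PartialConfig I =>
      M.condProb (M.nodeEvent u x.1 ∩ M.setEvent I x.2) (M.setEvent S s))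
    (q := fun x : Fin (M.k u) × M.PartialConfig I =>
      M.condProb (M.nodeEvent u x.1) (M.setEvent S s) *
        M.condProb (M.setEvent I x.2) (M.setEvent S s))
    (fun _ => condProb_nonneg _ _) (fun _ => mul_nonneg (condProb_nonneg _ _) (condProb_nonneg _ _))
    (fun x hx => ?_) ?_ ?_ (R, G)
  · rwa [Fintype.sum_prod_type] at h
  -- Absolute continuity: a joint probability is at most each of its marginals.
  · refine le_antisymm ?_ (condProb_nonneg _ _)
    rcases mul_eq_zero.1 hx with hx | hx
    · rw [← hx, ← sum_condProb_inter_setEvent (M.nodeEvent u x.1) _ I]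
      exact Finset.single_le_sum
        (f := fun G => M.condProb (M.nodeEvent u x.1 ∩ M.setEvent I G) (M.setEvent S s))
        (fun _ _ => condProb_nonneg _ _) (Finset.mem_univ x.2)
    · rw [← hx, ← sum_condProb_nodeEvent_inter (M.setEvent I x.2) _ u]
      exact Finset.single_le_sum
        (f := fun R => M.condProb (M.nodeEvent u R ∩ M.setEvent I x.2) (M.setEvent S s))
        (fun _ _ => condProb_nonneg _ _) (Finset.mem_univ x.1)
  · rw [Fintype.sum_prod_type]
    simp only [sum_condProb_inter_setEvent, hR1]
  · rw [Fintype.sum_prod_type]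
    simp only [← Finset.mul_sum, hG1, mul_one, hR1]

/-- If it were negative, the square root in the atom bound would be zero, the joint law would be the
product law, and every logarithmic term would vanish. -/
theorem mutualInfoGiven_nonneg (u : V) (I S : Finset V) (s : M.PartialConfig S) :
    0 ≤ M.mutualInfoGiven u I S s := by
  by_contra! h
  have hB := M.prob_setEvent_pos S s
  have h0 : ∀ R G, M.condProb (M.nodeEvent u R ∩ M.setEvent I G) (M.setEvent S s) =
      M.condProb (M.nodeEvent u R) (M.setEvent S s) *
        M.condProb (M.setEvent I G) (M.setEvent S s) := fun R G => by
    have := abs_condProb_sub_le_sqrt_mutualInfoGiven u I S s R G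
    rw [Real.sqrt_eq_zero_of_nonpos (by linarith)] at this
    exact sub_eq_zero.1 (abs_nonpos_iff.1 this)
  refine h.ne ?_
  rw [mutualInfoGiven]
  refine Finset.sum_eq_zero fun R _ => Finset.sum_eq_zero fun G _ => ?_
  rw [h0]
  rcases eq_or_ne (M.condProb (M.nodeEvent u R) (M.setEvent S s) *
    M.condProb (M.setEvent I G) (M.setEvent S s)) 0 with h | h
  · rw [h, zero_mul]
  · rw [div_self h, Real.log_one, mul_zero]

/-- The atom bound is uniform in `R` and `G`, so those averages disappear; concavity of the square
root, in the form of Cauchy-Schwarz with weights `Pr(X_S = s)`, does the rest. -/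
theorem nu_le_sqrt_condMutualInfo (u : V) (I S : Finset V) :
    M.nu u I S ≤ Real.sqrt (1 / 2 * M.condMutualInfo u I S) := by
  have hle : M.nu u I S ≤
      ∑ s, M.prob (M.setEvent S s) * Real.sqrt (1 / 2 * M.mutualInfoGiven u I S s) := by
    unfold nu
    refine Finset.expect_le Finset.univ_nonempty fun R _ =>
      Finset.expect_le Finset.univ_nonempty fun G _ => ?_
    exact Finset.sum_le_sum fun s _ => mul_le_mul_of_nonneg_left
      (abs_condProb_sub_le_sqrt_mutualInfoGiven u I S s R G) (prob_nonneg _)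
  refine hle.trans (Real.le_sqrt_of_sq_le ?_)
  have h := Finset.sum_sq_le_sum_mul_sum_of_sq_le_mul Finset.univ
    (r := fun s => M.prob (M.setEvent S s) * Real.sqrt (1 / 2 * M.mutualInfoGiven u I S s))
    (f := fun s => M.prob (M.setEvent S s))
    (g := fun s => M.prob (M.setEvent S s) * (1 / 2 * M.mutualInfoGiven u I S s))
    (fun s _ => prob_nonneg _)
    (fun s _ => mul_nonneg (prob_nonneg _)
      (mul_nonneg (by norm_num) (mutualInfoGiven_nonneg u I S s)))
    (fun s _ => by
      rw [mul_pow, Real.sq_sqrt (mul_nonneg (by norm_num) (mutualInfoGiven_nonneg u I S s))]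
      apply le_of_eq; ring)
  rw [sum_prob_setEvent, one_mul] at h
  refine h.trans (le_of_eq ?_)
  rw [condMutualInfo, Finset.mul_sum]
  exact Finset.sum_congr rfl fun s _ => by ring

/-! ### Wagers that depend on the states of few neighbors -/

theorem condCov_nodeEvent_eq_sum {B : Set M.Config} {I : Finset V} {f : M.Config → ℝ}
    {Φ : M.PartialConfig I → ℝ} (hf : ∀ x ∈ B, f x = Φ (I.restrict x)) {u : V}
    (R : Fin (M.k u)) :
    M.condCov B f ((M.nodeEvent u R).indicator 1) =
      ∑ G, Φ G * (M.condProb (M.nodeEvent u R ∩ M.setEvent I G) B -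
        M.condProb (M.nodeEvent u R) B * M.condProb (M.setEvent I G) B) := by
  have h1 : ∀ g : M.Config → ℝ, M.condMean B (fun x => f x * g x) =
      ∑ G, Φ G * M.condMean B (fun x => g x * (M.setEvent I G).indicator 1 x) := by
    intro g
    simp only [← condMean_const_mul, ← condMean_sum]
    refine condMean_congr fun x hx => ?_
    simp only [mul_left_comm _ (g x)]
    rw [← Finset.mul_sum, sum_indicator_setEvent I x Φ, hf x hx, mul_comm]
  have h2 := h1 fun _ => 1
  simp only [mul_one, one_mul] at h2
  rw [condCov, h1, h2]
  simp only [condProb_eq_condMean, Set.inter_indicator_one, Finset.sum_mul, mul_sub,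
    Finset.sum_sub_distrib]
  congr 1
  refine Finset.sum_congr rfl fun G _ => ?_
  rw [mul_comm (M.condMean B ((M.nodeEvent u R).indicator 1)), mul_assoc]

theorem card_partialConfig_le {K : ℕ} (hK : ∀ i, M.k i ≤ K) (I : Finset V) :
    Fintype.card (M.PartialConfig I) ≤ K ^ I.card := by
  rw [Fintype.card_pi]
  calc ∏ i : I, Fintype.card (Fin (M.k i)) ≤ ∏ _i : I, K :=
        Finset.prod_le_prod' fun i _ => by simpa using hK i
    _ = K ^ I.card := by simp

theorem nu_nonneg (u : V) (I S : Finset V) : 0 ≤ M.nu u I S :=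
  Finset.expect_nonneg fun _ _ => Finset.expect_nonneg fun _ _ =>
    Finset.sum_nonneg fun _ _ => mul_nonneg (prob_nonneg _) (abs_nonneg _)

theorem card_mul_nu (u : V) (I S : Finset V) :
    (M.k u : ℝ) * Fintype.card (M.PartialConfig I) * M.nu u I S =
      ∑ s, M.prob (M.setEvent S s) * ∑ R, ∑ G,
        |M.condProb (M.nodeEvent u R ∩ M.setEvent I G) (M.setEvent S s) -
          M.condProb (M.nodeEvent u R) (M.setEvent S s) *
            M.condProb (M.setEvent I G) (M.setEvent S s)| := by
  have hk := (natCast_k_pos (M := M) u).ne'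
  have hc : (Fintype.card (M.PartialConfig I) : ℝ) ≠ 0 := by
    exact_mod_cast Fintype.card_ne_zero
  rw [nu]
  simp only [Finset.expect_eq_sum_div_card, Finset.card_univ, Fintype.card_fin, ← Finset.sum_div]
  rw [div_div, mul_comm (Fintype.card _ : ℝ), mul_div_cancel₀ _ (mul_ne_zero hk hc),
    Finset.sum_congr rfl fun R _ => Finset.sum_comm, Finset.sum_comm]
  simp only [Finset.mul_sum]

/-- A bounded wager on `X_u` that looks only at `X_I` and `X_S` gains at most a multiple of `ν`. -/
theorem sum_condCov_le_nu {K : ℕ} (hK : ∀ i, M.k i ≤ K) {u : V} {I S : Finset V} {β : ℝ}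
    (hβ : 0 ≤ β) {f : Fin (M.k u) → M.Config → ℝ} (hf : ∀ R x, |f R x| ≤ β)
    (hdep : ∀ R x y, (∀ i ∈ I ∪ S, x i = y i) → f R x = f R y) :
    ∑ s, M.prob (M.setEvent S s) *
        ∑ R, M.condCov (M.setEvent S s) (f R) ((M.nodeEvent u R).indicator 1) ≤
      β * M.k u * (K : ℝ) ^ I.card * M.nu u I S := by
  have hcard : (Fintype.card (M.PartialConfig I) : ℝ) ≤ (K : ℝ) ^ I.card := by
    exact_mod_cast card_partialConfig_le hK I
  refine le_trans ?_ (mul_le_mul_of_nonneg_right (mul_le_mul_of_nonneg_left hcard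
    (mul_nonneg hβ (natCast_k_pos u).le)) (nu_nonneg u I S))
  rw [mul_assoc β, mul_assoc β, card_mul_nu, Finset.mul_sum]
  refine Finset.sum_le_sum fun s _ => ?_
  rw [mul_left_comm]
  refine mul_le_mul_of_nonneg_left ?_ (prob_nonneg _)
  rw [Finset.mul_sum]
  refine Finset.sum_le_sum fun R _ => ?_
  -- Given `X_S = s`, the wager is a function of `G` only. The default state off `I ∪ S` is harmless
  -- by `hdep`.
  rw [condCov_nodeEvent_eq_sum (I := I) (Φ := fun G => f R fun i =>
    if h : i ∈ I then G ⟨i, h⟩ else if h : i ∈ S then s ⟨i, h⟩ else ⟨0, M.k_pos i⟩), Finset.mul_sum]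
  · refine Finset.sum_le_sum fun G _ => (le_abs_self _).trans ?_
    rw [abs_mul]
    exact mul_le_mul_of_nonneg_right (hf _ _) (abs_nonneg _)
  · intro x hx
    refine hdep R _ _ fun i hi => ?_
    by_cases hI : i ∈ I
    · simp [hI, Finset.restrict]
    · have hS : i ∈ S := (Finset.mem_union.1 hi).resolve_left hI
      have hx : S.restrict x = s := hx
      simp [hI, hS, ← hx, Finset.restrict]

variable (M) in
/-- The wager on `X_u = R` placed after seeing `X_I` and `X_S`: every tensor that involves `u`, a
member of `T` and no vertex of `T` outside of `I` is weighted by the inverse of the probability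
that a random subset of `T` of size `m` contains its vertices in `T`. -/
noncomputable def wager (u : V) (T : Finset V) (m : ℕ) (I : Finset V) (R : Fin (M.k u))
    (x : M.Config) : ℝ :=
  ∑ h ∈ M.hyperedges with u ∈ h, if (h ∩ T).Nonempty ∧ h ∩ T ⊆ I then
    ((T.card.choose m : ℝ) / ((T.card - (h ∩ T).card).choose (m - (h ∩ T).card) : ℝ)) *
      M.potential h (h.restrict (Function.update x u R)) else 0

theorem abs_wager_le (u : V) (T : Finset V) (m : ℕ) (I : Finset V) (R : Fin (M.k u))
    (x : M.Config) : |M.wager u T m I R x| ≤ (T.card.choose m : ℝ) * M.gamma := by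
  refine (Finset.abs_sum_le_sum_abs _ _).trans (le_trans ?_ (mul_le_mul_of_nonneg_left
    (sum_maxEntry_le_gamma u) (Nat.cast_nonneg _)))
  rw [Finset.mul_sum]
  refine Finset.sum_le_sum fun h _ => ?_
  split_ifs with hc
  · rw [abs_mul]
    refine mul_le_mul ?_ (abs_potential_le _ _) (abs_nonneg _) (Nat.cast_nonneg _)
    rw [abs_of_nonneg (by positivity)]
    -- A zero denominator makes the weight `0`; otherwise the denominator is at least `1`.
    rcases Nat.eq_zero_or_pos ((T.card - (h ∩ T).card).choose (m - (h ∩ T).card)) with h0 | h0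
    · simp [h0]
    · exact div_le_self (Nat.cast_nonneg _) (by exact_mod_cast h0)
  · rw [abs_zero]
    exact mul_nonneg (Nat.cast_nonneg _) (maxEntry_nonneg _)

/-- The state of `u` is overwritten, and any other vertex of a contributing `h` is a neighbor of
`u`, hence in `S` or in `h ∩ T ⊆ I`. -/
theorem wager_congr {u : V} {S I : Finset V} (m : ℕ) (R : Fin (M.k u)) {x y : M.Config}
    (hxy : ∀ i ∈ I ∪ S, x i = y i) :
    M.wager u (M.graph.neighborFinset u \ S) m I R x =
      M.wager u (M.graph.neighborFinset u \ S) m I R y := by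
  unfold wager
  refine Finset.sum_congr rfl fun h hh => ?_
  obtain ⟨hh, hu⟩ := Finset.mem_filter.1 hh
  split_ifs with hc
  · congr 2
    ext1 ⟨i, hi⟩
    by_cases hiu : i = u
    · subst hiu; simp [Finset.restrict]
    · simp only [Finset.restrict]
      rw [Function.update_of_ne hiu, Function.update_of_ne hiu]
      refine hxy i (Finset.mem_union.2 ?_)
      by_cases hiS : i ∈ S
      · exact Or.inr hiS
      · exact Or.inl (hc.2 (Finset.mem_inter.2 ⟨hi, Finset.mem_sdiff.2
          ⟨erase_subset_neighborFinset hh hu (Finset.mem_erase.2 ⟨hiu, hi⟩), hiS⟩⟩))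
  · rfl

/-- The denominator of the weight counts the sets `I` containing `h ∩ T`, so every tensor meeting
`T` is recovered with the same coefficient. -/
theorem sum_wager {u : V} {T : Finset V} (hu : u ∉ T) (R : Fin (M.k u)) (x : M.Config) :
    ∑ I ∈ T.powersetCard (min (r - 1) T.card), M.wager u T (min (r - 1) T.card) I R x =
      (T.card.choose (min (r - 1) T.card) : ℝ) * ∑ h ∈ M.hyperedges with u ∈ h,
        if (h ∩ T).Nonempty then M.potential h (h.restrict (Function.update x u R)) else 0 := by
  set m := min (r - 1) T.card with hm
  unfold wager
  rw [Finset.sum_comm, Finset.mul_sum]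
  refine Finset.sum_congr rfl fun h hh => ?_
  obtain ⟨hh, huh⟩ := Finset.mem_filter.1 hh
  by_cases hne : (h ∩ T).Nonempty
  · simp only [hne, true_and, if_true]
    have hTle : (h ∩ T).card ≤ T.card := Finset.card_le_card Finset.inter_subset_right
    -- Sets of size `r - 1` suffice because `u` takes up one of the at most `r` vertices of `h`.
    have hle : (h ∩ T).card ≤ m := by
      refine le_min ?_ hTle
      have h1 : h ∩ T ⊆ h.erase u := fun i hi => Finset.mem_erase.2
        ⟨by rintro rfl; exact hu (Finset.mem_inter.1 hi).2, (Finset.mem_inter.1 hi).1⟩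
      have h2 := Finset.card_le_card h1
      rw [Finset.card_erase_of_mem huh] at h2
      exact h2.trans (Nat.sub_le_sub_right (M.card_le_of_mem h hh) 1)
    have hpos : 0 < (T.card - (h ∩ T).card).choose (m - (h ∩ T).card) :=
      Nat.choose_pos (Nat.sub_le_sub_right (min_le_right _ _) _)
    rw [← Finset.sum_filter, Finset.sum_const,
      Finset.card_filter_powersetCard_subset _ _ _ Finset.inter_subset_right hle, nsmul_eq_mul,
      ← mul_assoc, mul_div_cancel₀]
    exact_mod_cast hpos.ne'
  · simp [hne]

/-- Tensors that do not meet `T` are absent from the wagers, but given `X_S = s` they are constant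
in the local energy and have zero covariance with anything. -/
theorem sum_condCov_wager {u : V} {S : Finset V} (s : M.PartialConfig S) (R : Fin (M.k u))
    (g : M.Config → ℝ) :
    ∑ I ∈ M.testSets u S, M.condCov (M.setEvent S s)
        (M.wager u (M.graph.neighborFinset u \ S)
          (min (r - 1) (M.graph.neighborFinset u \ S).card) I R) g =
      ((M.testSets u S).card : ℝ) * M.condCov (M.setEvent S s) (M.localEnergy u R) g := by
  have hB := M.prob_setEvent_pos S s
  have huT : u ∉ M.graph.neighborFinset u \ S := by simp
  rw [← condCov_sum_left, testSets, Finset.card_powersetCard]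
  set T := M.graph.neighborFinset u \ S with hT
  simp only [sum_wager huT, condCov_const_mul_left]
  congr 1
  rw [condCov_sum_left]
  have hE : M.localEnergy u R = fun x => ∑ h ∈ M.hyperedges with u ∈ h,
    M.potential h (h.restrict (Function.update x u R)) := rfl
  rw [hE, condCov_sum_left]
  refine Finset.sum_congr rfl fun h hh => ?_
  obtain ⟨hh, hu⟩ := Finset.mem_filter.1 hh
  by_cases hne : (h ∩ T).Nonempty
  · simp only [hne, if_true]
  · simp only [hne, if_false]
    rw [condCov_const_left hB]
    obtain ⟨x₀, hx₀⟩ : (M.setEvent S s).Nonempty := by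
      by_contra hemp
      rw [Set.not_nonempty_iff_eq_empty] at hemp
      simp [hemp, prob] at hB
    rw [condCov_congr_left (f' := fun _ => M.potential h (h.restrict (Function.update x₀ u R))),
      condCov_const_left hB]
    intro x hx
    congr 1
    ext1 ⟨i, hi⟩
    by_cases hiu : i = u
    · subst hiu; simp [Finset.restrict]
    · simp only [Finset.restrict]
      rw [Function.update_of_ne hiu, Function.update_of_ne hiu]
      have hiS : i ∈ S := by
        by_contra hiS
        exact hne ⟨i, Finset.mem_inter.2 ⟨hi, Finset.mem_sdiff.2
          ⟨erase_subset_neighborFinset hh hu (Finset.mem_erase.2 ⟨hiu, hi⟩), hiS⟩⟩⟩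
      exact congrFun (hx.trans hx₀.symm : S.restrict x = S.restrict x₀) ⟨i, hiS⟩

theorem choose_min_le_choose {t m D : ℕ} (ht : t ≤ D) (hm : m ≤ D) :
    t.choose (min m t) ≤ D.choose m := by
  rcases le_total m t with h | h
  · rw [min_eq_left h]; exact Nat.choose_le_choose m ht
  · rw [min_eq_right h, Nat.choose_self]; exact Nat.choose_pos hm

theorem testSets_nonempty (u : V) (S : Finset V) : (M.testSets u S).Nonempty :=
  Finset.powersetCard_nonempty.2 (min_le_right _ _)

theorem exists_isMaximalHyperedge_superset {h : Finset V} (hh : h ∈ M.hyperedges) :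
    ∃ h', M.IsMaximalHyperedge h' ∧ h ⊆ h' := by
  obtain ⟨h', hh', hmax⟩ := (M.hyperedges.filter (h ⊆ ·)).exists_max_image Finset.card
    ⟨h, Finset.mem_filter.2 ⟨hh, Finset.Subset.refl h⟩⟩
  rw [Finset.mem_filter] at hh'
  refine ⟨h', ⟨hh'.1, ?_⟩, hh'.2⟩
  rintro ⟨h'', hh'', hlt, hsub⟩
  exact (hmax h'' (Finset.mem_filter.2 ⟨hh'', hh'.2.trans hsub⟩)).not_gt hlt

/-- The average of `ν` is bounded from below by the square of any entry of a tensor of a hyperedge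
that contains `u` and another vertex outside of `S`. -/
theorem delta_pow_mul_sq_potential_le (hM : M.IsCanonical) {K D : ℕ} (hK : ∀ i, M.k i ≤ K)
    (hD : ∀ i, M.graph.degree i ≤ D) (hrD : r - 1 ≤ D) {S h : Finset V}
    (hh : h ∈ M.hyperedges) {u i : V} (hu : u ∈ h) (huS : u ∉ S) (hi : i ∈ h) (hiu : i ≠ u)
    (hiS : i ∉ S) (a : M.PartialConfig h) :
    M.delta K ^ (M.graph.degree u + 2) * M.potential h a ^ 2 ≤
      (D.choose (r - 1) : ℝ) * M.gamma * (K : ℝ) ^ (r - 1) * 𝔼 I ∈ M.testSets u S, M.nu u I S := by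
  set T := M.graph.neighborFinset u \ S with hT
  set m := min (r - 1) T.card with hm
  set B := fun s => M.setEvent S s with hB
  have hK1 : 1 ≤ K := (M.k_pos u).trans_le (hK u)
  have hδ : 0 ≤ M.delta K := by unfold delta; positivity
  have hk := natCast_k_pos (M := M) u
  have hc : (0 : ℝ) < (M.testSets u S).card := by
    exact_mod_cast (testSets_nonempty u S).card_pos
  set β : ℝ := (D.choose (r - 1) : ℝ) * M.gamma with hβ
  have hβ0 : 0 ≤ β := mul_nonneg (Nat.cast_nonneg _) gamma_nonneg
  have hTD : T.card ≤ D := (Finset.card_le_card Finset.sdiff_subset).trans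
    ((SimpleGraph.card_neighborFinset_eq_degree _ _).trans_le (hD u))
  have upper : ∀ I ∈ M.testSets u S, ∑ s, M.prob (B s) * ∑ R, M.condCov (B s)
      (M.wager u T m I R) ((M.nodeEvent u R).indicator 1) ≤
        β * M.k u * (K : ℝ) ^ (r - 1) * M.nu u I S := by
    intro I hI
    refine (sum_condCov_le_nu hK hβ0 (fun R x => (abs_wager_le u T m I R x).trans ?_)
      (fun R x y hxy => wager_congr m R hxy)).trans ?_
    · refine mul_le_mul_of_nonneg_right ?_ gamma_nonneg
      exact_mod_cast choose_min_le_choose hTD hrD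
    · refine mul_le_mul_of_nonneg_right (mul_le_mul_of_nonneg_left ?_
        (mul_nonneg hβ0 hk.le)) (nu_nonneg _ _ _)
      refine pow_le_pow_right₀ (by exact_mod_cast hK1) ?_
      rw [(Finset.mem_powersetCard.1 hI).2]
      exact min_le_left _ _
  have lower : ∑ I ∈ M.testSets u S, ∑ s, M.prob (B s) * ∑ R, M.condCov (B s)
      (M.wager u T m I R) ((M.nodeEvent u R).indicator 1) =
      (M.testSets u S).card * ∑ s, M.prob (B s) * ∑ R, M.condCov (B s)
        (M.localEnergy u R) ((M.nodeEvent u R).indicator 1) := by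
    rw [Finset.sum_comm, Finset.mul_sum]
    refine Finset.sum_congr rfl fun s _ => ?_
    rw [← Finset.mul_sum, Finset.sum_comm, mul_left_comm, Finset.mul_sum (a := (_ : ℝ))]
    simp only [hB, hm, hT, sum_condCov_wager, Finset.mul_sum]
  -- Of the variances summed over `R`, only the one at the state that `a` gives to `u` is kept.
  have hvar : M.k u * (M.delta K ^ (M.graph.degree u + 2) * M.potential h a ^ 2) ≤
      ∑ s, M.prob (B s) * ∑ R, M.condCov (B s)
        (M.localEnergy u R) ((M.nodeEvent u R).indicator 1) := by
    calc M.k u * (M.delta K ^ (M.graph.degree u + 2) * M.potential h a ^ 2)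
        = M.delta K ^ 2 * M.k u *
          (M.delta K ^ M.graph.degree u * M.potential h a ^ 2) := by ring
      _ ≤ M.delta K ^ 2 * M.k u * ∑ s, M.prob (B s) * M.condCov (B s)
          (M.localEnergy u (a ⟨u, hu⟩)) (M.localEnergy u (a ⟨u, hu⟩)) :=
        mul_le_mul_of_nonneg_left (sum_prob_mul_condVar_localEnergy_ge hM hK hh hu hi hiu hiS a)
          (by positivity)
      _ ≤ _ := by
        rw [Finset.mul_sum]
        refine Finset.sum_le_sum fun s _ => ?_
        rw [mul_left_comm]
        refine mul_le_mul_of_nonneg_left ?_ (prob_nonneg _)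
        refine le_trans (mul_le_mul_of_nonneg_left ?_ (by positivity))
          (sum_condCov_nodeEvent_ge hM hK huS s)
        refine Finset.single_le_sum
          (f := fun R => M.condCov (B s) (M.localEnergy u R) (M.localEnergy u R))
          (fun R _ => ?_) (Finset.mem_univ _)
        rw [condCov_self_eq (M.prob_setEvent_pos S s)]
        exact condMean_nonneg _ fun x => sq_nonneg _
  have htot := Finset.sum_le_sum upper
  rw [lower, ← Finset.mul_sum] at htot
  have h3 := (mul_le_mul_of_nonneg_left hvar hc.le).trans htot
  rw [Finset.expect_eq_sum_div_card, ← mul_div_assoc, le_div_iff₀ hc]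
  refine le_of_mul_le_mul_left ?_ hk
  linarith

end MarkovRandomField

/-! ### Comparison of constants and the theorem -/

/-- The bound already obtained is stronger than the one required. The relation `K e δ = 1` absorbs
one power of `δ`; then `r ≥ 2` gives `4 ≤ r ^ (2 r)` and `r + d - 1 ≥ d + 1`. -/
theorem four_mul_pow_le {r d K : ℕ} (hr : 2 ≤ r) (hK : 1 ≤ K) {δ e : ℝ} (hδ0 : 0 ≤ δ)
    (hδ1 : δ ≤ 1) (hδ : (K : ℝ) * e * δ = 1) :
    4 * δ ^ (r + d - 1) ≤ (r : ℝ) ^ (2 * r) * (K : ℝ) ^ 2 * e * δ ^ (d + 2) := by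
  have hr' : (2 : ℝ) ≤ r := by exact_mod_cast hr
  have hK' : (1 : ℝ) ≤ K := by exact_mod_cast hK
  have h1 : (4 : ℝ) ≤ (r : ℝ) ^ (2 * r) := by
    calc (4 : ℝ) = 2 ^ 2 := by norm_num
      _ ≤ (r : ℝ) ^ 2 := by gcongr
      _ ≤ (r : ℝ) ^ (2 * r) := pow_le_pow_right₀ (by linarith) (by omega)
  have h2 : δ ^ (r + d - 1) ≤ δ ^ (d + 1) := pow_le_pow_of_le_one hδ0 hδ1 (by omega)
  have h3 : (r : ℝ) ^ (2 * r) * (K : ℝ) ^ 2 * e * δ ^ (d + 2) =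
      (r : ℝ) ^ (2 * r) * K * δ ^ (d + 1) := by
    calc _ = (r : ℝ) ^ (2 * r) * K * δ ^ (d + 1) * (K * e * δ) := by ring
      _ = _ := by rw [hδ, mul_one]
  rw [h3]
  refine mul_le_mul ?_ h2 (pow_nonneg hδ0 _) (by positivity)
  nlinarith

theorem theorem5p4 {V : Type*} [Fintype V] [DecidableEq V] {r : ℕ}
    (M : MarkovRandomField V r) (hcanon : M.IsCanonical)
    (K D : ℕ) (hK : ∀ i, M.k i ≤ K) (hD : ∀ i, M.graph.degree i ≤ D) (hrD : r - 1 ≤ D)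
    (α : ℝ) (hα : 0 < α) (u : V)
    (hu : ∀ h : Finset V, M.IsMaximalHyperedge h → u ∈ h → M.IsNonvanishing α h)
    (S : Finset V) (huS : u ∉ S) (hS : ¬ M.graph.neighborFinset u ⊆ S) :
    (𝔼 I ∈ M.testSets u S, M.nu u I S ≤
      𝔼 I ∈ M.testSets u S, Real.sqrt (1 / 2 * M.condMutualInfo u I S)) ∧
    4 * α ^ 2 * M.delta K ^ (r + M.graph.degree u - 1) /
        ((r : ℝ) ^ (2 * r) * (K : ℝ) ^ (r + 1) * (D.choose (r - 1) : ℝ) *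
          M.gamma * Real.exp (2 * M.gamma)) ≤
      𝔼 I ∈ M.testSets u S, M.nu u I S := by
  refine ⟨Finset.expect_le_expect fun I _ => M.nu_le_sqrt_condMutualInfo u I S, ?_⟩
  obtain ⟨i, hi, hiS⟩ := Finset.not_subset.1 hS
  rw [SimpleGraph.mem_neighborFinset] at hi
  obtain ⟨hne, h₀, hh₀, hu₀, hi₀⟩ := hi
  -- Maximality serves only to supply an entry of size at least `α`; the enlarged hyperedge still
  -- contains `u` and `i`.
  obtain ⟨h, hmax, hsub⟩ := MarkovRandomField.exists_isMaximalHyperedge_superset hh₀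
  obtain ⟨a, ha⟩ := hu h hmax (hsub hu₀)
  have key := M.delta_pow_mul_sq_potential_le hcanon hK hD hrD hmax.1 (hsub hu₀) huS (hsub hi₀)
    hne.symm hiS a
  set E := 𝔼 I ∈ M.testSets u S, M.nu u I S with hE
  have hr : 2 ≤ r := by
    refine le_trans ?_ (M.card_le_of_mem h₀ hh₀)
    exact Finset.one_lt_card.2 ⟨u, hu₀, i, hi₀, hne⟩
  have hK1 : 1 ≤ K := (M.k_pos u).trans_le (hK u)
  have hK0 : (0 : ℝ) < K := by exact_mod_cast hK1
  -- The nonvanishing entry at `u` forces `γ ≥ α`, so the denominator is positive.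
  have hγ : 0 < M.gamma := by
    refine hα.trans_le (ha.trans ((MarkovRandomField.abs_potential_le h a).trans ?_))
    exact (Finset.single_le_sum (f := M.maxEntry)
      (fun h _ => MarkovRandomField.maxEntry_nonneg h)
      (Finset.mem_filter.2 ⟨hmax.1, hsub hu₀⟩)).trans
        (MarkovRandomField.sum_maxEntry_le_gamma u)
  have hD0 : (0 : ℝ) < (D.choose (r - 1) : ℝ) := by exact_mod_cast Nat.choose_pos hrD
  have hr0 : (0 : ℝ) < r := by exact_mod_cast (by omega : 0 < r)
  have hδ0 := (M.delta_pos hK1).le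
  have hδ : (K : ℝ) * Real.exp (2 * M.gamma) * M.delta K = 1 := by
    rw [MarkovRandomField.delta]
    field_simp
    rw [← Real.exp_add]; simp
  have hα2 : α ^ 2 ≤ M.potential h a ^ 2 := by
    rw [← sq_abs (M.potential h a)]
    gcongr
  rw [div_le_iff₀ (by positivity)]
  have hpow : (K : ℝ) ^ (r + 1) = (K : ℝ) ^ 2 * (K : ℝ) ^ (r - 1) := by
    rw [← pow_add]; congr 1; omega
  calc 4 * α ^ 2 * M.delta K ^ (r + M.graph.degree u - 1)
      = 4 * M.delta K ^ (r + M.graph.degree u - 1) * α ^ 2 := by ring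
    _ ≤ (r : ℝ) ^ (2 * r) * (K : ℝ) ^ 2 * Real.exp (2 * M.gamma) *
          M.delta K ^ (M.graph.degree u + 2) * α ^ 2 :=
        mul_le_mul_of_nonneg_right
          (four_mul_pow_le hr hK1 hδ0 (M.delta_le_one K) hδ) (sq_nonneg α)
    _ ≤ (r : ℝ) ^ (2 * r) * (K : ℝ) ^ 2 * Real.exp (2 * M.gamma) *
          (M.delta K ^ (M.graph.degree u + 2) * M.potential h a ^ 2) := by
        rw [mul_assoc _ (M.delta K ^ _)]
        gcongr
    _ ≤ (r : ℝ) ^ (2 * r) * (K : ℝ) ^ 2 * Real.exp (2 * M.gamma) *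
          ((D.choose (r - 1) : ℝ) * M.gamma * (K : ℝ) ^ (r - 1) * E) :=
        mul_le_mul_of_nonneg_left key (by positivity)
    _ = _ := by rw [hpow]; ring
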